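/- For $n\ge 0$ put $[n]=\{1,\dots,n\}$ and $\pm[n]=\{\pm1,\dots,\pm n\}$. Let $\mathfrak{S}_n$ be the symmetric group on $[n]$, and let $\mathcal{B}_n$ be the set of signed permutations, i.e. the permutations $\pi$ of $\pm[n]$ with $\pi(-i)=-\pi(i)$ for all $i$. Put $$\mathrm{des}_A(\pi)=\#\{i\in\{1,\dots,n-1\}:\pi(i)>\pi(i+1)\}\quad(\pi\in\mathfrak{S}_n),$$ $$\mathrm{des}_B(\pi)=\#\{i\in\{0,1,\dots,n-1\}:\pi(i)>\pi(i+1)\}\quad(\pi\in\mathcal{B}_n,\ \pi(0)=0),$$ and define the Eulerian polynomials of types $A$ and $B$ by $$A_n(x)=\sum_{\pi\in\mathfrak{S}_n}x^{\mathrm{des}_A(\pi)},\qquad B_n(x)=\sum_{\pi\in\mathcal{B}_n}x^{\mathrm{des}_B(\pi)}.$$ A perfect matching of $[2n]$ is a partition of $[2n]$ into $n$ blocks of size $2$. Let $\mathcal{M}_{2n}$ be the set of perfect matchings of $[2n]$ and, for $\mathrm{M}\in\mathcal{M}_{2n}$, let $\mathrm{el}(\mathrm{M})$ (resp. $\mathrm{ol}(\mathrm{M})$)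 be the number of blocks of $\mathrm{M}$ whose larger entry is even (resp. odd). Put $$N_n(x)=\sum_{\mathrm{M}\in\mathcal{M}_{2n}}x^{\mathrm{el}(\mathrm{M})},\qquad M_n(x)=\sum_{\mathrm{M}\in\mathcal{M}_{2n}}x^{\mathrm{ol}(\mathrm{M})},$$ so that $N_0(x)=M_0(x)=1$. Then $$2^n x A_n(x)=\sum_{k=0}^n\binom{n}{k}N_k(x)N_{n-k}(x)\qquad\text{for all } n\ge 1,$$ $$B_n(x)=\sum_{k=0}^n\binom{n}{k}N_k(x)M_{n-k}(x)\qquad\text{for all } n\ge 0.$$ -/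

import Mathlib

open Polynomial

namespace EulerianMatching

/-- The number of descents of a permutation of an `n`-element chain: the number of positions `i`
that have a successor `i + 1` with `π (i + 1) < π i`. -/
def desA {n : ℕ} (π : Equiv.Perm (Fin n)) : ℕ :=
  (Finset.univ.filter fun i : Fin n =>
    ∃ h : (i : ℕ) + 1 < n, π ⟨(i : ℕ) + 1, h⟩ < π i).card

/-- The type `A` Eulerian polynomial `A_n(x)`. -/
noncomputable def eulerianA (n : ℕ) : ℤ[X] :=
  ∑ π : Equiv.Perm (Fin n), X ^ desA π

/-- The set `±[n] = {±1, ±2, …, ±n}`. -/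
noncomputable def plusMinus (n : ℕ) : Finset ℤ :=
  (Finset.Icc (-(n : ℤ)) (n : ℤ)).erase 0

/-- Signed permutations: the permutations `π` of `±[n]` with `π (-i) = -π i` for all `i`. -/
abbrev SignedPerm (n : ℕ) : Type :=
  {π : Equiv.Perm (plusMinus n) //
    ∀ i j : plusMinus n, (j : ℤ) = -(i : ℤ) → (π j : ℤ) = -(π i : ℤ)}

/-- The word `π(0) π(1) ⋯ π(n)` of a signed permutation, with `π(0) = 0`
(the value is irrelevant at indices larger than `n`). -/
noncomputable def SignedPerm.word {n : ℕ} (π : SignedPerm n) (i : ℕ) : ℤ :=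
  if h : (i : ℤ) ∈ plusMinus n then ((π.1 ⟨(i : ℤ), h⟩ : plusMinus n) : ℤ) else 0

/-- The number of type `B` descents: the `i ∈ {0, …, n - 1}` with `π(i) > π(i + 1)`. -/
noncomputable def desB {n : ℕ} (π : SignedPerm n) : ℕ :=
  ((Finset.range n).filter fun i => SignedPerm.word π i > SignedPerm.word π (i + 1)).card

/-- The type `B` Eulerian polynomial `B_n(x)`. -/
noncomputable def eulerianB (n : ℕ) : ℤ[X] :=
  ∑ π : SignedPerm n, X ^ desB π

/-- The perfect matchings of `[2n] = {1, …, 2n}`: partitions into blocks of size `2`. -/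
abbrev PerfectMatching (n : ℕ) : Type :=
  {P : Finpartition (Finset.Icc 1 (2 * n)) // ∀ b ∈ P.parts, b.card = 2}

/-- The number of blocks whose larger entry is even (`b.sup id` is the largest entry of `b`). -/
def el {n : ℕ} (P : PerfectMatching n) : ℕ :=
  (P.1.parts.filter fun b => Even (b.sup id)).card

/-- The number of blocks whose larger entry is odd. -/
def ol {n : ℕ} (P : PerfectMatching n) : ℕ :=
  (P.1.parts.filter fun b => Odd (b.sup id)).card

/-- `N_n(x)`: perfect matchings of `[2n]` counted by blocks with even larger entry. -/
noncomputable def matchingN (n : ℕ) : ℤ[X] :=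
  ∑ P : PerfectMatching n, X ^ el P

/-- `M_n(x)`: perfect matchings of `[2n]` counted by blocks with odd larger entry. -/
noncomputable def matchingM (n : ℕ) : ℤ[X] :=
  ∑ P : PerfectMatching n, X ^ ol P

end EulerianMatching

namespace EulerianMatching

/-! ### Descents of words -/

/-! All four polynomial families satisfy first-order differential recurrences, and both identities
follow by comparing recurrences. Building permutations by inserting the largest letter, or signed
permutations by inserting a letter of largest absolute value, gives A_{n+1} = (1 + nx) A_n + x(1-x)
A_n' and B_{n+1} = (1 + (2n+1)x) B_n + 2x(1-x) B_n'. Building matchings by adding the points 2n+1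
and 2n+2 gives N_{n+1} = (x + 2nx) N_n + 2x(1-x) N_n' and M_{n+1} = (1 + 2nx) M_n + 2x(1-x) M_n'.

The last two share the derivation 2x(1-x) d/dx and the growth term 2nx. By Pascal's rule and the
Leibniz rule, a binomial convolution of such sequences obeys the same kind of recurrence, with the
constant terms added (`binomConv_succ_of_recurrence`). For N with M the constant is 1 + x, which is
the recurrence of B_n; for N with N it is 2x, which is the recurrence of 2^n x A_n.

Descents are counted on lists (`sum_insert_max`, `sum_insert_min`), and matchings are handled as
involutions (`extendEquiv`, `sum_extend`). -/

/-- The number of descents of a word. -/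
def wordDes {α : Type*} [LinearOrder α] : List α → ℕ
  | [] => 0
  | [_] => 0
  | a :: b :: l => (if b < a then 1 else 0) + wordDes (b :: l)

theorem wordDes_map_range {α : Type*} [LinearOrder α] (n : ℕ) (f : ℕ → α) :
    wordDes ((List.range (n + 1)).map f) =
      ((Finset.range n).filter fun i => f (i + 1) < f i).card := by
  induction n generalizing f with
  | zero => simp [wordDes]
  | succ n ih =>
    have h := ih (f ∘ Nat.succ)
    rw [List.range_succ_eq_map] at h ⊢
    rw [List.range_succ_eq_map]
    simp only [List.map_cons, List.map_map, wordDes] at h ⊢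
    rw [Finset.card_filter, Finset.sum_range_succ', add_comm, ← Finset.card_filter]
    simp only [Function.comp_def, Nat.succ_eq_add_one, zero_add] at h ⊢
    rw [h]

/-- Turns the statistic `d`, which appears as a multiplicity when insertion gaps are counted, into a
derivative of the generating polynomial. -/
theorem X_mul_derivative_X_pow (d : ℕ) :
    (X : ℤ[X]) * derivative (X ^ d) = (d : ℤ[X]) * X ^ d := by
  cases d with
  | zero => simp
  | succ d => rw [derivative_X_pow]; simp; ring

/-- Inserting a letter larger than all others into a word with a fixed first letter. -/
theorem sum_insert_max {α : Type*} [LinearOrder α] (m : α) (ts : List α) (p : α) (hp : p < m)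
    (hts : ∀ t ∈ ts, t < m) :
    ((List.permutations'Aux m ts).map fun l => (X : ℤ[X]) ^ wordDes (p :: l)).sum =
      X ^ wordDes (p :: ts) *
        (((wordDes (p :: ts) : ℤ[X]) + 1) +
          ((ts.length : ℤ[X]) - (wordDes (p :: ts) : ℤ[X])) * X) := by
  induction ts generalizing p with
  | nil => simp [wordDes, hp.le]
  | cons t r ih =>
    have ht : t < m := hts t (by simp)
    have h := ih t ht (fun u hu => hts u (by simp [hu]))
    -- Inserting between `p` and `t` makes one descent `m > t`, whatever the order of `p` and `t`;
    -- the later gaps are the induction hypothesis with `t` as fixed first letter.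
    simp only [List.permutations'Aux, List.map_cons, List.map_map, List.sum_cons,
      Function.comp_def, wordDes, pow_add, List.sum_map_mul_left, h, if_pos ht, if_neg hp.not_gt,
      List.length_cons]
    split_ifs <;> push_cast <;> ring

/-- Inserting a letter smaller than all others into a word with a fixed first letter. -/
theorem sum_insert_min {α : Type*} [LinearOrder α] (m : α) (ts : List α) (p : α) (hp : m < p)
    (hts : ∀ t ∈ ts, m < t) :
    ((List.permutations'Aux m ts).map fun l => (X : ℤ[X]) ^ wordDes (p :: l)).sum =
      X ^ wordDes (p :: ts) *
        ((wordDes (p :: ts) : ℤ[X]) +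
          ((ts.length : ℤ[X]) + 1 - (wordDes (p :: ts) : ℤ[X])) * X) := by
  induction ts generalizing p with
  | nil => simp [wordDes, hp]
  | cons t r ih =>
    have ht : m < t := hts t (by simp)
    have h := ih t ht (fun u hu => hts u (by simp [hu]))
    -- Here the descent created is `p > m`. Unlike a maximum, a minimum placed at the end also adds
    -- a descent.
    simp only [List.permutations'Aux, List.map_cons, List.map_map, List.sum_cons,
      Function.comp_def, wordDes, pow_add, List.sum_map_mul_left, h, if_pos hp, if_neg ht.not_gt,
      List.length_cons]
    split_ifs <;> push_cast <;> ring

/-! ### Type `A` -/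

/-- The words of the permutations of `{0, …, n - 1}`. -/
def wordsA : ℕ → List (List ℕ)
  | 0 => [[]]
  | n + 1 => (wordsA n).flatMap (List.permutations'Aux n)

theorem wordsA_eq (n : ℕ) : wordsA n = (List.range n).reverse.permutations' := by
  induction n with
  | zero => rfl
  | succ n ih => simp [wordsA, ih, List.range_succ]

theorem mem_wordsA {n : ℕ} {l : List ℕ} : l ∈ wordsA n ↔ l.Perm (List.range n) := by
  rw [wordsA_eq, List.mem_permutations']
  exact ⟨fun h => h.trans (List.reverse_perm _), fun h => h.trans (List.reverse_perm _).symm⟩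

theorem nodup_wordsA (n : ℕ) : (wordsA n).Nodup := by
  rw [wordsA_eq, ← (List.permutations_perm_permutations' _).nodup_iff]
  exact List.nodup_permutations _ (List.nodup_reverse.2 List.nodup_range)

theorem sum_flatMap_insert_max (n : ℕ) (L : List (List ℕ))
    (hL : ∀ l ∈ L, l.Perm (List.range n)) :
    ((L.flatMap (List.permutations'Aux n)).map fun l => (X : ℤ[X]) ^ wordDes (0 :: l)).sum =
      (1 + (n : ℤ[X]) * X) * (L.map fun l => (X : ℤ[X]) ^ wordDes (0 :: l)).sum +
        X * (1 - X) * derivative (L.map fun l => (X : ℤ[X]) ^ wordDes (0 :: l)).sum := by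
  induction L with
  | nil => simp
  | cons l L ih =>
    have hl : l.Perm (List.range n) := hL l (by simp)
    have h := ih fun u hu => hL u (by simp [hu])
    have hlen : l.length = n := by simpa using hl.length_eq
    -- For `n = 0` the inserted letter equals the leading 0, so it is not strictly larger and
    -- `sum_insert_max` does not apply.
    rcases Nat.eq_zero_or_pos n with rfl | hn
    · simp_all [wordDes]
      ring
    · have hs := sum_insert_max n l 0 hn fun t ht => List.mem_range.1 (hl.mem_iff.1 ht)
      simp only [List.flatMap_cons, List.map_append, List.sum_append, List.map_cons,
        List.sum_cons, h, hs, derivative_add, hlen]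
      linear_combination -(1 - X) * X_mul_derivative_X_pow (wordDes (0 :: l))

/-! ### Type `B` -/

/-- The words of the signed permutations of `{±1, …, ±n}`. -/
def wordsB : ℕ → List (List ℤ)
  | 0 => [[]]
  | n + 1 => (wordsB n).flatMap fun l =>
      List.permutations'Aux ((n : ℤ) + 1) l ++ List.permutations'Aux (-((n : ℤ) + 1)) l

theorem mem_permutations'Aux_iff {α : Type*} {m : α} {l ts : List α} :
    l ∈ List.permutations'Aux m ts ↔ ∃ s t, ts = s ++ t ∧ l = s ++ m :: t := by
  induction ts generalizing l with
  | nil => simp [List.permutations'Aux]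
  | cons a r ih =>
    simp only [List.permutations'Aux, List.mem_cons, List.mem_map, ih]
    constructor
    · rintro (rfl | ⟨_, ⟨s, t, rfl, rfl⟩, rfl⟩)
      · exact ⟨[], a :: r, rfl, rfl⟩
      · exact ⟨a :: s, t, rfl, rfl⟩
    · rintro ⟨s, t, h, rfl⟩
      cases s with
      | nil => left; simp_all
      | cons b s =>
        simp only [List.cons_append, List.cons.injEq] at h
        obtain ⟨rfl, rfl⟩ := h
        exact Or.inr ⟨_, ⟨s, t, rfl, rfl⟩, rfl⟩

/-- The unique letter of absolute value `n + 1` can be deleted, and its sign tells which of the two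
insertions produced it. -/
theorem mem_wordsB {n : ℕ} {l : List ℤ} :
    l ∈ wordsB n ↔ (l.map Int.natAbs).Perm (List.range' 1 n) := by
  induction n generalizing l with
  | zero => simp [wordsB]
  | succ n ih =>
    have hr : (List.range' 1 (n + 1)).Perm ((n + 1) :: List.range' 1 n) := by
      rw [List.range'_concat]
      simp [add_comm]
    simp only [wordsB, List.mem_flatMap, List.mem_append, mem_permutations'Aux_iff]
    constructor
    · rintro ⟨l', hl', h⟩
      obtain ⟨x, hx, s, t, rfl, rfl⟩ : ∃ x : ℤ, x.natAbs = n + 1 ∧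
          ∃ s t, l' = s ++ t ∧ l = s ++ x :: t := by
        rcases h with h | h
        · exact ⟨_, by omega, h⟩
        · exact ⟨_, by omega, h⟩
      refine ((List.perm_middle.map _).trans ?_).trans hr.symm
      rw [List.map_cons, hx]
      exact (ih.1 hl').cons _
    · intro h
      have h' := h.trans hr
      obtain ⟨x, hxl, hx⟩ := List.mem_map.1 (h'.mem_iff.2 (List.mem_cons_self))
      obtain ⟨s, t, rfl⟩ := List.append_of_mem hxl
      refine ⟨s ++ t, ih.2 ?_, ?_⟩
      · have h2 := ((List.perm_middle (l₁ := s) (a := x)).map Int.natAbs).symm.trans h'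
        rw [List.map_cons, hx] at h2
        exact h2.cons_inv
      · rcases Int.natAbs_eq x with hx' | hx' <;> rw [hx] at hx'
        · exact Or.inl ⟨s, t, rfl, by simp [hx']⟩
        · exact Or.inr ⟨s, t, rfl, by simp [hx']⟩

theorem natAbs_mem_of_mem_wordsB {n : ℕ} {l : List ℤ} (hl : l ∈ wordsB n) {x : ℤ} (hx : x ∈ l) :
    1 ≤ x.natAbs ∧ x.natAbs ≤ n := by
  have h := (mem_wordsB.1 hl).mem_iff.1 (List.mem_map_of_mem hx)
  rw [List.mem_range'_1] at h
  omega

theorem nodup_of_mem_wordsB {n : ℕ} {l : List ℤ} (hl : l ∈ wordsB n) :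
    (l.map Int.natAbs).Nodup :=
  (mem_wordsB.1 hl).nodup_iff.2 List.nodup_range'

/-- The parent word can be recovered, so insertions into different words never collide. -/
theorem filter_eq_of_mem_permutations'Aux {n : ℕ} {l l' : List ℤ} (hl : l ∈ wordsB n) {x : ℤ} (hx : x.natAbs = n + 1)
    (h : l' ∈ List.permutations'Aux x l) : l'.filter (fun y => y.natAbs ≤ n) = l := by
  obtain ⟨s, t, rfl, rfl⟩ := mem_permutations'Aux_iff.1 h
  have h1 : ¬ x.natAbs ≤ n := by omega
  rw [List.filter_append, List.filter_cons_of_neg (by simpa using h1), ← List.filter_append,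
    List.filter_eq_self]
  intro a ha
  simpa using (natAbs_mem_of_mem_wordsB hl ha).2

theorem nodup_wordsB (n : ℕ) : (wordsB n).Nodup := by
  induction n with
  | zero => simp [wordsB]
  | succ n ih =>
    rw [wordsB, List.nodup_flatMap]
    have key : ∀ l ∈ wordsB n, ∀ x : ℤ, x.natAbs = n + 1 → x ∉ l := fun l hl x hx hxl => by
      have := natAbs_mem_of_mem_wordsB hl hxl
      omega
    constructor
    · intro l hl
      rw [List.nodup_append']
      refine ⟨List.nodup_permutations'Aux_of_notMem _ _ (key l hl _ (by omega)),
        List.nodup_permutations'Aux_of_notMem _ _ (key l hl _ (by omega)), ?_⟩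
      intro l' h1 h2
      obtain ⟨s, t, hst, h1⟩ := mem_permutations'Aux_iff.1 h1
      have hm : (n : ℤ) + 1 ∈ l' := by simp [h1]
      obtain ⟨s, t, hst, h2⟩ := mem_permutations'Aux_iff.1 h2
      rw [h2, List.mem_append, List.mem_cons] at hm
      have hl' := key l hl ((n : ℤ) + 1) (by omega)
      rw [hst, List.mem_append] at hl'
      have : (n : ℤ) + 1 ≠ -((n : ℤ) + 1) := by omega
      tauto
    · refine (List.pairwise_iff_forall_sublist.2 ?_)
      intro a b hab
      have hne : a ≠ b := by
        have := hab.nodup ih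
        simpa using this
      have ha : a ∈ wordsB n := hab.subset (by simp)
      have hb : b ∈ wordsB n := hab.subset (by simp)
      intro l' h1 h2
      apply hne
      rw [List.mem_append] at h1 h2
      have e1 : l'.filter (fun y => y.natAbs ≤ n) = a := by
        rcases h1 with h | h <;> exact filter_eq_of_mem_permutations'Aux ha (by omega) h
      have e2 : l'.filter (fun y => y.natAbs ≤ n) = b := by
        rcases h2 with h | h <;> exact filter_eq_of_mem_permutations'Aux hb (by omega) h
      exact e1.symm.trans e2

/-- With `d` descents, the insertions of `n + 1` contribute (d+1) + (n-d)x and those of `-(n + 1)`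
contribute d + (n+1-d)x, relative to x^d. -/
theorem sum_flatMap_insert_signed (n : ℕ) (L : List (List ℤ)) (hL : ∀ l ∈ L, l ∈ wordsB n) :
    ((L.flatMap fun l => List.permutations'Aux ((n : ℤ) + 1) l ++
        List.permutations'Aux (-((n : ℤ) + 1)) l).map
          fun l => (X : ℤ[X]) ^ wordDes (0 :: l)).sum =
      (1 + (2 * (n : ℤ[X]) + 1) * X) * (L.map fun l => (X : ℤ[X]) ^ wordDes (0 :: l)).sum +
        2 * X * (1 - X) * derivative (L.map fun l => (X : ℤ[X]) ^ wordDes (0 :: l)).sum := by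
  induction L with
  | nil => simp
  | cons l L ih =>
    have hl : l ∈ wordsB n := hL l (by simp)
    have h := ih fun u hu => hL u (by simp [hu])
    have hlen : l.length = n := by simpa using (mem_wordsB.1 hl).length_eq
    have h1 := sum_insert_max ((n : ℤ) + 1) l 0 (by omega) fun t ht => by
      have := natAbs_mem_of_mem_wordsB hl ht
      omega
    have h2 := sum_insert_min (-((n : ℤ) + 1)) l 0 (by omega) fun t ht => by
      have := natAbs_mem_of_mem_wordsB hl ht
      omega
    simp only [List.flatMap_cons, List.map_append, List.sum_append, List.map_cons,
      List.sum_cons, h, h1, h2, derivative_add, hlen]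
    linear_combination -2 * (1 - X) * X_mul_derivative_X_pow (wordDes (0 :: l))

/-! ### Permutations as words. -/

/-- The word `0, π(0), …, π(n - 1)`. -/
def permWord {n : ℕ} (π : Equiv.Perm (Fin n)) (i : ℕ) : ℕ :=
  if h : i < n then π ⟨i, h⟩ else 0

/-- No natural number is below 0, so the leading 0 creates no descent; it lets both types use the
same insertion lemmas. -/
theorem desA_eq_wordDes {n : ℕ} (π : Equiv.Perm (Fin n)) :
    desA π = wordDes (0 :: (List.range n).map (permWord π)) := by
  cases n with
  | zero => simp [desA, wordDes]
  | succ n =>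
    have h0 : wordDes (0 :: (List.range (n + 1)).map (permWord π)) =
        wordDes ((List.range (n + 1)).map (permWord π)) := by
      rw [List.range_succ_eq_map]
      simp [wordDes]
    rw [h0, wordDes_map_range, desA]
    refine Finset.card_bij (fun i _ => (i : ℕ)) ?_ (fun a _ b _ h => Fin.ext h) ?_
    · intro i hi
      obtain ⟨h, hlt⟩ := (Finset.mem_filter.1 hi).2
      rw [Finset.mem_filter, Finset.mem_range]
      refine ⟨by omega, ?_⟩
      rw [permWord, permWord, dif_pos h, dif_pos i.2]
      exact hlt
    · intro i hi
      rw [Finset.mem_filter, Finset.mem_range] at hi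
      have h1 : i < n + 1 := by omega
      have h2 : i + 1 < n + 1 := by omega
      refine ⟨⟨i, h1⟩, ?_, rfl⟩
      rw [Finset.mem_filter]
      refine ⟨Finset.mem_univ _, h2, ?_⟩
      have := hi.2
      rw [permWord, permWord, dif_pos h1, dif_pos h2] at this
      exact this

theorem eulerianA_eq_sum_words (n : ℕ) :
    eulerianA n = ((wordsA n).map fun l => (X : ℤ[X]) ^ wordDes (0 :: l)).sum := by
  rw [← List.sum_toFinset _ (nodup_wordsA n), eulerianA]
  refine Finset.sum_bij (fun π _ => (List.range n).map (permWord π)) ?_ ?_ ?_ ?_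
  · intro π _
    rw [List.mem_toFinset, mem_wordsA]
    refine (List.perm_ext_iff_of_nodup ?_ List.nodup_range).2 ?_
    · refine List.Nodup.map_on ?_ List.nodup_range
      intro x hx y hy h
      rw [List.mem_range] at hx hy
      rw [permWord, permWord, dif_pos hx, dif_pos hy] at h
      simpa using π.injective (Fin.ext h)
    · intro a
      simp only [List.mem_map, List.mem_range]
      constructor
      · rintro ⟨i, hi, rfl⟩
        rw [permWord, dif_pos hi]
        exact (π _).2
      · intro ha
        exact ⟨π.symm ⟨a, ha⟩, (π.symm ⟨a, ha⟩).2, by simp [permWord]⟩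
  · intro π _ ρ _ h
    ext i
    have := List.map_inj_left.1 h i (List.mem_range.2 i.2)
    simpa [permWord] using this
  · intro l hl
    rw [List.mem_toFinset, mem_wordsA] at hl
    have hlen : l.length = n := by simpa using hl.length_eq
    have hnd : l.Nodup := hl.nodup_iff.2 List.nodup_range
    let f : Fin n → Fin n := fun i =>
      ⟨l[(i : ℕ)]'(by omega), List.mem_range.1 (hl.mem_iff.1 (List.getElem_mem _))⟩
    have hf : Function.Injective f := fun i j h =>
      Fin.ext ((hnd.getElem_inj_iff).1 (Fin.mk.inj_iff.1 h))
    refine ⟨Equiv.ofBijective f (Finite.injective_iff_bijective.1 hf), Finset.mem_univ _, ?_⟩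
    refine List.ext_getElem (by simp [hlen]) fun i h1 h2 => ?_
    have hi : i < n := by omega
    simp [permWord, hi, f]
  · intro π _
    rw [desA_eq_wordDes]

theorem eulerianA_succ (n : ℕ) :
    eulerianA (n + 1) =
      (1 + (n : ℤ[X]) * X) * eulerianA n + X * (1 - X) * derivative (eulerianA n) := by
  rw [eulerianA_eq_sum_words, eulerianA_eq_sum_words, wordsA]
  exact sum_flatMap_insert_max n _ fun l hl => mem_wordsA.1 hl

/-! ### Signed permutations as words. -/

theorem mem_plusMinus {n : ℕ} {i : ℤ} : i ∈ plusMinus n ↔ 1 ≤ i.natAbs ∧ i.natAbs ≤ n := by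
  rw [plusMinus, Finset.mem_erase, Finset.mem_Icc]
  omega

theorem desB_eq_wordDes {n : ℕ} (π : SignedPerm n) :
    desB π = wordDes (0 :: (List.range n).map fun i => π.word (i + 1)) := by
  have h := wordDes_map_range n π.word
  have h0 : π.word 0 = 0 := by
    rw [SignedPerm.word, dif_neg]
    rw [mem_plusMinus]
    simp
  rw [List.range_succ_eq_map, List.map_cons, h0, List.map_map] at h
  exact h.symm

theorem word_succ {n : ℕ} (π : SignedPerm n) (i : ℕ) (hi : i < n) :
    π.word (i + 1) = π.1 ⟨((i + 1 : ℕ) : ℤ), mem_plusMinus.2 (by omega)⟩ := by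
  rw [SignedPerm.word, dif_pos]

theorem SignedPerm.ext_word {n : ℕ} {π ρ : SignedPerm n}
    (h : ∀ i < n, π.word (i + 1) = ρ.word (i + 1)) : π = ρ := by
  have key : ∀ (k : ℕ) (hk : (k : ℤ) ∈ plusMinus n),
      (π.1 ⟨k, hk⟩ : ℤ) = ρ.1 ⟨k, hk⟩ := by
    intro k hk
    have hk' := mem_plusMinus.1 hk
    have hkp : 1 ≤ k ∧ k ≤ n := by omega
    obtain ⟨i, rfl⟩ : ∃ i, k = i + 1 := ⟨k - 1, by omega⟩
    have := h i (by omega)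
    rwa [word_succ π i (by omega), word_succ ρ i (by omega)] at this
  apply Subtype.ext
  ext ⟨x, hx⟩
  have hx' := mem_plusMinus.1 hx
  rcases Int.natAbs_eq x with hxe | hxe
  · have := key x.natAbs (by rwa [← hxe])
    convert this using 4
  · have hm : (x.natAbs : ℤ) ∈ plusMinus n := mem_plusMinus.2 (by omega)
    have h1 := π.2 ⟨(x.natAbs : ℤ), hm⟩ ⟨x, hx⟩ hxe
    have h2 := ρ.2 ⟨(x.natAbs : ℤ), hm⟩ ⟨x, hx⟩ hxe
    rw [h1, h2, key]

/-- The odd extension of a word `l` with letters `l₁, …, lₙ` to `{±1, …, ±n}`. -/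
def oddExtension (l : List ℤ) (i : ℤ) : ℤ :=
  i.sign * l.getD (i.natAbs - 1) 0

theorem natAbs_oddExtension {n : ℕ} {l : List ℤ} (hl : l ∈ wordsB n) {i : ℤ}
    (hi : i ∈ plusMinus n) :
    ∃ h : i.natAbs - 1 < (l.map Int.natAbs).length,
      (oddExtension l i).natAbs = (l.map Int.natAbs)[i.natAbs - 1] := by
  have hlen : l.length = n := by simpa using (mem_wordsB.1 hl).length_eq
  rw [mem_plusMinus] at hi
  have h : i.natAbs - 1 < l.length := by omega
  refine ⟨by simpa using h, ?_⟩
  have hs : i.sign.natAbs = 1 := by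
    rw [Int.natAbs_sign, if_neg (by omega)]
  simp [oddExtension, Int.natAbs_mul, hs, h]

theorem exists_signedPerm_of_mem_wordsB {n : ℕ} {l : List ℤ} (hl : l ∈ wordsB n) :
    ∃ π : SignedPerm n, (List.range n).map (fun i => π.word (i + 1)) = l := by
  have hlen : l.length = n := by simpa using (mem_wordsB.1 hl).length_eq
  have hmem : ∀ i : plusMinus n, oddExtension l i ∈ plusMinus n := by
    intro i
    obtain ⟨h, e⟩ := natAbs_oddExtension hl i.2
    have := (mem_wordsB.1 hl).mem_iff.1 (List.getElem_mem h)
    rw [List.mem_range'_1] at this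
    rw [mem_plusMinus, e]
    omega
  let f : plusMinus n → plusMinus n := fun i => ⟨oddExtension l i, hmem i⟩
  have hodd : ∀ i : ℤ, oddExtension l (-i) = -oddExtension l i := by
    intro i
    simp [oddExtension]
  have hf : Function.Injective f := by
    intro i j hij
    have hij' : oddExtension l i = oddExtension l j := Subtype.ext_iff.1 hij
    obtain ⟨h1, e1⟩ := natAbs_oddExtension hl i.2
    obtain ⟨h2, e2⟩ := natAbs_oddExtension hl j.2
    rw [hij', e2] at e1
    have e3 := ((nodup_of_mem_wordsB hl).getElem_inj_iff).1 e1
    have hi := mem_plusMinus.1 i.2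
    have hj := mem_plusMinus.1 j.2
    have h0 := mem_plusMinus.1 (hmem i)
    apply Subtype.ext
    -- If `i = -j`, oddness makes the common value its own negative, hence 0, which is not in
    -- `±[n]`.
    rcases Int.natAbs_eq_natAbs_iff.1 (show (i : ℤ).natAbs = (j : ℤ).natAbs by omega) with h | h
    · exact h
    · rw [h, hodd] at hij'
      rw [h, hodd] at h0
      omega
  refine ⟨⟨Equiv.ofBijective f (Finite.injective_iff_bijective.1 hf), ?_⟩, ?_⟩
  · intro i j hij
    change oddExtension l j = -oddExtension l i
    rw [hij, hodd]
  · refine List.ext_getElem (by simp [hlen]) fun i h1 h2 => ?_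
    rw [List.getElem_map, List.getElem_range, word_succ _ _ (by omega)]
    change oddExtension l ((i + 1 : ℕ) : ℤ) = _
    have : ((i + 1 : ℕ) : ℤ).sign = 1 := Int.sign_eq_one_of_pos (by omega)
    rw [oddExtension, this, Int.natAbs_natCast, Nat.add_sub_cancel]
    simp [h2]

theorem eulerianB_eq_sum_words (n : ℕ) :
    eulerianB n = ((wordsB n).map fun l => (X : ℤ[X]) ^ wordDes (0 :: l)).sum := by
  rw [← List.sum_toFinset _ (nodup_wordsB n), eulerianB]
  refine Finset.sum_bij (fun π _ => (List.range n).map fun i => π.word (i + 1)) ?_ ?_ ?_ ?_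
  · intro π _
    have hinj : ∀ i < n, ∀ j < n, (π.word (i + 1)).natAbs = (π.word (j + 1)).natAbs → i = j := by
      intro i hi j hj h
      rw [word_succ π i hi, word_succ π j hj] at h
      rcases Int.natAbs_eq_natAbs_iff.1 h with h | h
      · have := Subtype.ext_iff.1 (π.1.injective (Subtype.ext h))
        simp only at this
        omega
      -- Oddness turns the value `-π(j + 1)` into `π(-(j + 1))`; injectivity then equates a positive
      -- and a negative index.
      · have hneg : -((j + 1 : ℕ) : ℤ) ∈ plusMinus n := mem_plusMinus.2 (by omega)
        rw [← π.2 _ ⟨-((j + 1 : ℕ) : ℤ), hneg⟩ rfl] at h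
        have := Subtype.ext_iff.1 (π.1.injective (Subtype.ext h))
        simp only at this
        omega
    have hnd : (((List.range n).map fun i => π.word (i + 1)).map Int.natAbs).Nodup := by
      rw [List.map_map]
      refine List.Nodup.map_on ?_ List.nodup_range
      intro x hx y hy h
      exact hinj x (List.mem_range.1 hx) y (List.mem_range.1 hy) h
    rw [List.mem_toFinset, mem_wordsB]
    refine (List.subperm_of_subset hnd ?_).perm_of_length_le (by simp)
    intro a ha
    simp only [List.mem_map, List.mem_range] at ha
    obtain ⟨_, ⟨i, hi, rfl⟩, rfl⟩ := ha
    rw [word_succ π i hi, List.mem_range'_1]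
    have := mem_plusMinus.1 (π.1 ⟨((i + 1 : ℕ) : ℤ), mem_plusMinus.2 (by omega)⟩).2
    omega
  · intro π _ ρ _ h
    exact SignedPerm.ext_word fun i hi => List.map_inj_left.1 h i (List.mem_range.2 hi)
  · intro l hl
    obtain ⟨π, hπ⟩ := exists_signedPerm_of_mem_wordsB (List.mem_toFinset.1 hl)
    exact ⟨π, Finset.mem_univ _, hπ⟩
  · intro π _
    rw [desB_eq_wordDes]

theorem eulerianB_succ (n : ℕ) :
    eulerianB (n + 1) =
      (1 + (2 * (n : ℤ[X]) + 1) * X) * eulerianB n +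
        2 * X * (1 - X) * derivative (eulerianB n) := by
  rw [eulerianB_eq_sum_words, eulerianB_eq_sum_words, wordsB]
  exact sum_flatMap_insert_signed n _ fun l hl => hl

/-! ### Perfect matchings as involutions -/

/-- The involutions of `ℕ` that move exactly the elements of `{1, …, 2n}`. -/
abbrev FreeInvolution (n : ℕ) : Type :=
  {σ : Equiv.Perm ℕ // (∀ i, σ (σ i) = i) ∧ ∀ i, σ i ≠ i ↔ 1 ≤ i ∧ i ≤ 2 * n}

theorem FreeInvolution.mapsTo {n : ℕ} (σ : FreeInvolution n) {i : ℕ} (hi : 1 ≤ i ∧ i ≤ 2 * n) :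
    1 ≤ σ.1 i ∧ σ.1 i ≤ 2 * n := by
  rw [← σ.2.2, σ.2.1]
  exact ((σ.2.2 i).2 hi).symm

theorem FreeInvolution.apply_eq {n : ℕ} (σ : FreeInvolution n) {i : ℕ} (hi : 2 * n < i) :
    σ.1 i = i := by
  by_contra h
  have := (σ.2.2 i).1 h
  omega

theorem part_eq_pair {n : ℕ} (P : PerfectMatching n) {a : ℕ} (ha : a ∈ Finset.Icc 1 (2 * n)) :
    ∃ b, b ≠ a ∧ b ∈ Finset.Icc 1 (2 * n) ∧ P.1.part a = {a, b} ∧ P.1.part b = {b, a} := by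
  have hp := P.1.part_mem.2 ha
  obtain ⟨x, y, hxy, h⟩ := Finset.card_eq_two.1 (P.2 _ hp)
  have key : ∃ b, b ≠ a ∧ P.1.part a = {a, b} := by
    have : a ∈ P.1.part a := P.1.mem_part_self.2 ha
    rw [h, Finset.mem_insert, Finset.mem_singleton] at this
    rcases this with rfl | rfl
    · exact ⟨y, hxy.symm, h⟩
    · exact ⟨x, hxy, by rw [h, Finset.pair_comm]⟩
  obtain ⟨b, hb, h⟩ := key
  have hbm : b ∈ P.1.part a := by simp [h]
  refine ⟨b, hb, P.1.part_subset a hbm, h, ?_⟩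
  rw [P.1.part_eq_of_mem hp hbm, h, Finset.pair_comm]

/-- The other element of the block of `a`. -/
def partner {n : ℕ} (P : PerfectMatching n) (a : ℕ) : ℕ :=
  if a ∈ Finset.Icc 1 (2 * n) then ∑ x ∈ P.1.part a, x - a else a

/-- The block sum is `a + b`, so the truncated subtraction defining `partner` is exact. -/
theorem partner_eq {n : ℕ} (P : PerfectMatching n) {a b : ℕ} (ha : a ∈ Finset.Icc 1 (2 * n))
    (hb : b ≠ a) (h : P.1.part a = {a, b}) : partner P a = b := by
  rw [partner, if_pos ha, h, Finset.sum_pair hb.symm, Nat.add_sub_cancel_left]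

theorem partner_spec {n : ℕ} (P : PerfectMatching n) {a : ℕ} (ha : a ∈ Finset.Icc 1 (2 * n)) :
    partner P a ≠ a ∧ P.1.part a = {a, partner P a} ∧ partner P (partner P a) = a := by
  obtain ⟨b, hb, hbm, h, h'⟩ := part_eq_pair P ha
  rw [partner_eq P ha hb h]
  exact ⟨hb, h, partner_eq P hbm hb.symm h'⟩

theorem partner_of_notMem {n : ℕ} (P : PerfectMatching n) {a : ℕ}
    (ha : a ∉ Finset.Icc 1 (2 * n)) : partner P a = a := by
  rw [partner, if_neg ha]

theorem partner_partner {n : ℕ} (P : PerfectMatching n) (a : ℕ) :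
    partner P (partner P a) = a := by
  by_cases ha : a ∈ Finset.Icc 1 (2 * n)
  · exact (partner_spec P ha).2.2
  · rw [partner_of_notMem P ha, partner_of_notMem P ha]

/-- The involution that swaps the two elements of every block. -/
def toInvolution {n : ℕ} (P : PerfectMatching n) : FreeInvolution n :=
  ⟨⟨partner P, partner P, partner_partner P, partner_partner P⟩, partner_partner P, fun i => by
    rw [← Finset.mem_Icc]
    refine ⟨fun h => ?_, fun h => (partner_spec P h).1⟩
    by_contra hi
    exact h (partner_of_notMem P hi)⟩

/-- The matching whose blocks are the orbits of a fixed point free involution. -/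
def ofInvolution {n : ℕ} (σ : FreeInvolution n) : PerfectMatching n :=
  ⟨Finpartition.ofExistsUnique ((Finset.Icc 1 (2 * n)).image fun a => {a, σ.1 a})
    (by
      intro p hp
      obtain ⟨a, ha, rfl⟩ := Finset.mem_image.1 hp
      rw [Finset.insert_subset_iff, Finset.singleton_subset_iff]
      exact ⟨ha, Finset.mem_Icc.2 (σ.mapsTo (Finset.mem_Icc.1 ha))⟩)
    (by
      intro a ha
      refine ⟨{a, σ.1 a}, ⟨Finset.mem_image_of_mem _ ha, by simp⟩, ?_⟩
      rintro t ⟨ht, hat⟩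
      obtain ⟨b, hb, rfl⟩ := Finset.mem_image.1 ht
      rw [Finset.mem_insert, Finset.mem_singleton] at hat
      rcases hat with rfl | rfl
      · rfl
      · rw [σ.2.1, Finset.pair_comm])
    (by
      intro h
      obtain ⟨a, _, ha⟩ := Finset.mem_image.1 h
      exact Finset.insert_ne_empty _ _ ha), by
    intro b hb
    obtain ⟨a, ha, rfl⟩ := Finset.mem_image.1 hb
    exact Finset.card_pair ((σ.2.2 a).2 (Finset.mem_Icc.1 ha)).symm⟩

theorem parts_ofInvolution {n : ℕ} (σ : FreeInvolution n) :
    (ofInvolution σ).1.parts = (Finset.Icc 1 (2 * n)).image fun a => {a, σ.1 a} :=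
  rfl

/-- Perfect matchings are the same as fixed point free involutions. -/
def matchingEquiv (n : ℕ) : PerfectMatching n ≃ FreeInvolution n where
  toFun := toInvolution
  invFun := ofInvolution
  left_inv P := by
    apply Subtype.ext
    apply Finpartition.ext
    rw [parts_ofInvolution]
    ext t
    rw [Finset.mem_image]
    constructor
    · rintro ⟨a, ha, rfl⟩
      change {a, partner P a} ∈ P.1.parts
      rw [← (partner_spec P ha).2.1]
      exact P.1.part_mem.2 ha
    · intro ht
      obtain ⟨a, ha⟩ := P.1.nonempty_of_mem_parts ht
      have ham := P.1.le ht ha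
      refine ⟨a, ham, ?_⟩
      change {a, partner P a} = t
      rw [← (partner_spec P ham).2.1, P.1.part_eq_of_mem ht ha]
  right_inv σ := by
    apply Subtype.ext
    ext a
    change partner (ofInvolution σ) a = σ.1 a
    by_cases ha : a ∈ Finset.Icc 1 (2 * n)
    · refine partner_eq _ ha ((σ.2.2 a).2 (Finset.mem_Icc.1 ha)) ?_
      exact (ofInvolution σ).1.part_eq_of_mem (Finset.mem_image_of_mem _ ha) (by simp)
    · rw [partner_of_notMem _ ha]
      by_contra h
      exact ha (Finset.mem_Icc.2 ((σ.2.2 a).1 (Ne.symm h)))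

noncomputable instance (n : ℕ) : Fintype (FreeInvolution n) :=
  Fintype.ofEquiv _ (matchingEquiv n)

/-! ### Larger entries of blocks. -/

/-- The larger entries of the blocks. -/
def closers {n : ℕ} (σ : FreeInvolution n) : Finset ℕ :=
  (Finset.Icc 1 (2 * n)).filter fun i => σ.1 i < i

theorem card_parts_filter_sup {n : ℕ} (σ : FreeInvolution n) (p : ℕ → Prop) [DecidablePred p] :
    ((ofInvolution σ).1.parts.filter fun b => p (b.sup id)).card =
      ((closers σ).filter p).card := by
  symm
  refine Finset.card_nbij' (fun a => {a, σ.1 a}) (fun b => b.sup id) ?_ ?_ ?_ ?_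
  · intro a ha
    simp only [closers, Finset.coe_filter, Finset.mem_filter, Set.mem_ofPred_eq] at ha ⊢
    refine ⟨Finset.mem_image_of_mem _ ha.1.1, ?_⟩
    simpa [ha.1.2.le] using ha.2
  · intro b hb
    simp only [closers, Finset.coe_filter, Finset.mem_filter, Set.mem_ofPred_eq] at hb ⊢
    obtain ⟨hb, hp⟩ := hb
    obtain ⟨a, ha, rfl⟩ := Finset.mem_image.1 hb
    simp only [Finset.sup_insert, Finset.sup_singleton, id] at hp ⊢
    refine ⟨?_, hp⟩
    have h1 := Finset.mem_Icc.1 ha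
    have h2 := σ.mapsTo h1
    have h3 := (σ.2.2 a).2 h1
    rcases lt_or_gt_of_ne h3 with h | h
    · rw [sup_eq_left.2 h.le]
      exact ⟨ha, h⟩
    · rw [sup_eq_right.2 h.le, σ.2.1]
      exact ⟨Finset.mem_Icc.2 h2, h⟩
  · intro a ha
    simp only [closers, Finset.coe_filter, Finset.mem_filter, Set.mem_ofPred_eq] at ha
    simpa using ha.1.2.le
  · intro b hb
    simp only [Finset.coe_filter, Set.mem_ofPred_eq] at hb
    obtain ⟨a, ha, rfl⟩ := Finset.mem_image.1 hb.1
    simp only [Finset.sup_insert, Finset.sup_singleton, id]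
    rcases le_total (σ.1 a) a with h | h
    · rw [sup_eq_left.2 h]
    · rw [sup_eq_right.2 h, σ.2.1, Finset.pair_comm]

/-- Every block has two elements, one of which is its larger entry. -/
theorem sum_max_eq_two_mul_sum_closers {n : ℕ} (σ : FreeInvolution n) {R : Type*} [Semiring R]
    (g : ℕ → R) :
    ∑ a ∈ Finset.Icc 1 (2 * n), g (max a (σ.1 a)) = 2 * ∑ a ∈ closers σ, g a := by
  rw [← Finset.sum_filter_add_sum_filter_not _ (fun i => σ.1 i < i),
    two_mul (∑ a ∈ closers σ, g a)]
  congr 1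
  · refine Finset.sum_congr rfl fun a ha => ?_
    rw [max_eq_left (Finset.mem_filter.1 ha).2.le]
  · refine Finset.sum_nbij' (fun a => σ.1 a) (fun a => σ.1 a) ?_ ?_ (fun a _ => σ.2.1 a)
      (fun a _ => σ.2.1 a) ?_
    · intro a ha
      rw [Finset.mem_filter, Finset.mem_Icc] at ha
      have := (σ.2.2 a).2 ha.1
      rw [closers, Finset.mem_filter, σ.2.1, Finset.mem_Icc]
      exact ⟨σ.mapsTo ha.1, by omega⟩
    · intro a ha
      rw [closers, Finset.mem_filter, Finset.mem_Icc] at ha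
      rw [Finset.mem_filter, σ.2.1, Finset.mem_Icc]
      exact ⟨σ.mapsTo ha.1, by omega⟩
    · intro a ha
      rw [max_eq_right (not_lt.1 (Finset.mem_filter.1 ha).2)]

theorem card_closers {n : ℕ} (σ : FreeInvolution n) : (closers σ).card = n := by
  have h := sum_max_eq_two_mul_sum_closers σ (fun _ => (1 : ℕ))
  simp at h
  exact h.symm

/-! ### Adding two points to a matching -/

/-- Add the block `{2n + 1, 2n + 2}`. -/
def addBlock {n : ℕ} (σ : FreeInvolution n) : FreeInvolution (n + 1) :=
  ⟨σ.1 * Equiv.swap (2 * n + 1) (2 * n + 2), by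
    have h1 := σ.apply_eq (i := 2 * n + 1) (by omega)
    have h2 := σ.apply_eq (i := 2 * n + 2) (by omega)
    have hne : ∀ i j, σ.1 j = j → i ≠ j → σ.1 i ≠ j := fun i j hj hij h =>
      hij (σ.1.injective (h.trans hj.symm))
    have key : ∀ i, i ≠ 2 * n + 1 → i ≠ 2 * n + 2 →
        (σ.1 * Equiv.swap (2 * n + 1) (2 * n + 2)) i = σ.1 i := fun i hi hi' => by
      rw [Equiv.Perm.mul_apply, Equiv.swap_apply_of_ne_of_ne hi hi']
    refine ⟨fun i => ?_, fun i => ?_⟩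
    · by_cases hi : i = 2 * n + 1
      · subst hi; simp [h1, h2]
      by_cases hi' : i = 2 * n + 2
      · subst hi'; simp [h1, h2]
      rw [key i hi hi', key _ (hne _ _ h1 hi) (hne _ _ h2 hi'), σ.2.1]
    · by_cases hi : i = 2 * n + 1
      · subst hi; simp [h2]
      by_cases hi' : i = 2 * n + 2
      · subst hi'; simp [h1]; omega
      rw [key i hi hi', σ.2.2]
      omega⟩

/-- Conjugation of a fixed point free involution by a transposition. -/
def conjSwap {n : ℕ} (σ : FreeInvolution n) (a b : ℕ) (ha : 1 ≤ a ∧ a ≤ 2 * n)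
    (hb : 1 ≤ b ∧ b ≤ 2 * n) : FreeInvolution n :=
  ⟨Equiv.swap a b * σ.1 * Equiv.swap a b, by
    refine ⟨fun i => ?_, fun i => ?_⟩
    · simp [σ.2.1]
    · have h1 : (Equiv.swap a b * σ.1 * Equiv.swap a b) i ≠ i ↔
          σ.1 (Equiv.swap a b i) ≠ Equiv.swap a b i := by
        rw [Equiv.Perm.mul_apply, Equiv.Perm.mul_apply, Ne, Ne, Equiv.swap_apply_eq_iff]
      rw [h1, σ.2.2, Equiv.swap_apply_def]
      split_ifs <;> omega⟩

/-- Remove the block `{2n + 1, 2n + 2}`. -/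
def removeBlock {n : ℕ} (σ : FreeInvolution (n + 1)) (h : σ.1 (2 * n + 2) = 2 * n + 1) :
    FreeInvolution n :=
  ⟨σ.1 * Equiv.swap (2 * n + 1) (2 * n + 2), by
    have h' : σ.1 (2 * n + 1) = 2 * n + 2 := by rw [← h, σ.2.1]
    have key : ∀ i, i ≠ 2 * n + 1 → i ≠ 2 * n + 2 →
        (σ.1 * Equiv.swap (2 * n + 1) (2 * n + 2)) i = σ.1 i := fun i hi hi' => by
      rw [Equiv.Perm.mul_apply, Equiv.swap_apply_of_ne_of_ne hi hi']
    have hne : ∀ i j k, σ.1 j = k → i ≠ j → σ.1 i ≠ k := fun i j k hj hij h =>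
      hij (σ.1.injective (h.trans hj.symm))
    refine ⟨fun i => ?_, fun i => ?_⟩
    · by_cases hi : i = 2 * n + 1
      · subst hi; simp [h]
      by_cases hi' : i = 2 * n + 2
      · subst hi'; simp [h']
      rw [key i hi hi', key _ (hne _ _ _ h hi') (hne _ _ _ h' hi), σ.2.1]
    · by_cases hi : i = 2 * n + 1
      · subst hi; simp [h]
      by_cases hi' : i = 2 * n + 2
      · subst hi'; simp [h']
      rw [key i hi hi', σ.2.2]
      omega⟩

/-- Add the points `2n + 1` and `2n + 2`, the latter being matched with `a`. -/
def extend {n : ℕ} (σ : FreeInvolution n) (a : Finset.Icc 1 (2 * n + 1)) :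
    FreeInvolution (n + 1) :=
  conjSwap (addBlock σ) a (2 * n + 1)
    (by have := Finset.mem_Icc.1 a.2; omega) (by omega)

theorem extend_val {n : ℕ} (σ : FreeInvolution n) (a : Finset.Icc 1 (2 * n + 1)) :
    (extend σ a).1 = Equiv.swap (a : ℕ) (2 * n + 1) *
      (σ.1 * Equiv.swap (2 * n + 1) (2 * n + 2)) * Equiv.swap (a : ℕ) (2 * n + 1) :=
  rfl

theorem extend_apply_top {n : ℕ} (σ : FreeInvolution n) (a : Finset.Icc 1 (2 * n + 1)) :
    (extend σ a).1 (2 * n + 2) = a := by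
  have ha := Finset.mem_Icc.1 a.2
  have h1 := σ.apply_eq (i := 2 * n + 1) (by omega)
  rw [extend_val, Equiv.Perm.mul_apply, Equiv.swap_apply_of_ne_of_ne (by omega) (by omega)]
  simp [h1]

theorem top_mem {n : ℕ} (σ : FreeInvolution (n + 1)) :
    σ.1 (2 * n + 2) ∈ Finset.Icc 1 (2 * n + 1) := by
  have h1 := σ.mapsTo (i := 2 * n + 2) (by omega)
  have h2 := (σ.2.2 (2 * n + 2)).2 (by omega)
  rw [Finset.mem_Icc]
  omega

/-- Every fixed point free involution of `{1, …, 2n + 2}` arises once by adding two points. -/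
def extendEquiv (n : ℕ) :
    FreeInvolution n × Finset.Icc 1 (2 * n + 1) ≃ FreeInvolution (n + 1) where
  toFun x := extend x.1 x.2
  -- The chosen point is the partner of `2n + 2`; swapping its role with `2n + 1` restores the block
  -- `{2n + 1, 2n + 2}`.
  invFun σ := (removeBlock (conjSwap σ (σ.1 (2 * n + 2)) (2 * n + 1)
      (by have := Finset.mem_Icc.1 (top_mem σ); omega) (by omega)) (by
        have := Finset.mem_Icc.1 (top_mem σ)
        change (Equiv.swap _ _ * σ.1 * Equiv.swap _ _ : Equiv.Perm ℕ) _ = _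
        rw [Equiv.Perm.mul_apply, Equiv.swap_apply_of_ne_of_ne (by omega) (by omega)]
        simp), ⟨σ.1 (2 * n + 2), top_mem σ⟩)
  left_inv := by
    rintro ⟨σ, a⟩
    have ha := extend_apply_top σ a
    refine Prod.ext (Subtype.ext ?_) (Subtype.ext ha)
    change Equiv.swap ((extend σ a).1 (2 * n + 2)) _ * (extend σ a).1 *
      Equiv.swap ((extend σ a).1 (2 * n + 2)) _ * Equiv.swap _ _ = σ.1
    rw [ha, extend_val]
    simp [mul_assoc]
  right_inv σ := by
    apply Subtype.ext
    change Equiv.swap _ _ * (Equiv.swap _ _ * σ.1 * Equiv.swap _ _ * Equiv.swap _ _ *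
      Equiv.swap _ _) * Equiv.swap _ _ = σ.1
    simp [mul_assoc]

/-- For `a ≤ 2n` the block `{a, σ a}` is broken into `{a, 2n + 2}` and `{σ a, 2n + 1}`; all other
blocks survive. -/
theorem extend_apply_of_le {n : ℕ} (σ : FreeInvolution n) (a : Finset.Icc 1 (2 * n + 1)) {i : ℕ}
    (hi : i ≤ 2 * n) :
    (extend σ a).1 i =
      if i = a then 2 * n + 2 else if σ.1 i = a then 2 * n + 1 else σ.1 i := by
  have ha := Finset.mem_Icc.1 a.2
  have h1 := σ.apply_eq (i := 2 * n + 1) (by omega)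
  have h2 := σ.apply_eq (i := 2 * n + 2) (by omega)
  rw [extend_val, Equiv.Perm.mul_apply, Equiv.Perm.mul_apply, Equiv.Perm.mul_apply]
  split_ifs with h h'
  · rw [h, Equiv.swap_apply_left, Equiv.swap_apply_left, h2,
      Equiv.swap_apply_of_ne_of_ne (by omega) (by omega)]
  · rw [Equiv.swap_apply_of_ne_of_ne h (show i ≠ 2 * n + 1 by omega),
      Equiv.swap_apply_of_ne_of_ne (show i ≠ 2 * n + 1 by omega) (by omega), h',
      Equiv.swap_apply_left]
  · have h3 : σ.1 i ≠ 2 * n + 1 := fun h => by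
      have := σ.1.injective (h.trans h1.symm)
      omega
    rw [Equiv.swap_apply_of_ne_of_ne h (show i ≠ 2 * n + 1 by omega),
      Equiv.swap_apply_of_ne_of_ne (show i ≠ 2 * n + 1 by omega) (by omega),
      Equiv.swap_apply_of_ne_of_ne h' h3]

theorem extend_apply_penultimate {n : ℕ} (σ : FreeInvolution n) (a : Finset.Icc 1 (2 * n + 1)) :
    (extend σ a).1 (2 * n + 1) = if (a : ℕ) = 2 * n + 1 then 2 * n + 2 else σ.1 a := by
  have ha := Finset.mem_Icc.1 a.2
  have h2 := σ.apply_eq (i := 2 * n + 2) (by omega)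
  rw [extend_val, Equiv.Perm.mul_apply, Equiv.Perm.mul_apply, Equiv.Perm.mul_apply]
  split_ifs with h
  · simp [h, h2]
  · have h3 := σ.mapsTo (i := a) (by omega)
    have h4 := (σ.2.2 a).2 (by omega)
    rw [Equiv.swap_apply_right, Equiv.swap_apply_of_ne_of_ne h (by omega),
      Equiv.swap_apply_of_ne_of_ne h4 (by omega)]

theorem closers_extend_last {n : ℕ} (σ : FreeInvolution n) (a : Finset.Icc 1 (2 * n + 1))
    (ha : (a : ℕ) = 2 * n + 1) : closers (extend σ a) = insert (2 * n + 2) (closers σ) := by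
  ext i
  simp only [closers, Finset.mem_filter, Finset.mem_insert, Finset.mem_Icc]
  rcases lt_trichotomy i (2 * n + 1) with hi | rfl | hi
  · rw [extend_apply_of_le σ a (by omega)]
    by_cases h1 : 1 ≤ i
    · have := σ.mapsTo (i := i) (by omega)
      rw [if_neg (by omega), if_neg (by omega)]
      omega
    · omega
  · rw [extend_apply_penultimate, if_pos ha]
    omega
  · by_cases h : i = 2 * n + 2
    · subst h
      rw [extend_apply_top, ha]
      omega
    · omega

theorem closers_extend {n : ℕ} (σ : FreeInvolution n) (a : Finset.Icc 1 (2 * n + 1))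
    (ha : (a : ℕ) ≤ 2 * n) :
    closers (extend σ a) =
      insert (2 * n + 1) (insert (2 * n + 2) ((closers σ).erase (max (a : ℕ) (σ.1 a)))) := by
  have ha1 := (Finset.mem_Icc.1 a.2).1
  have hsa := σ.mapsTo ⟨ha1, ha⟩
  ext i
  simp only [closers, Finset.mem_filter, Finset.mem_insert, Finset.mem_Icc, Finset.mem_erase]
  rcases lt_trichotomy i (2 * n + 1) with hi | rfl | hi
  · rw [extend_apply_of_le σ a (by omega)]
    have h3 : σ.1 i = a ↔ i = σ.1 a := by
      constructor
      · intro h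
        rw [← h, σ.2.1]
      · intro h
        rw [h, σ.2.1]
    split_ifs with h1 h2
    · subst h1
      omega
    · have h4 := h3.1 h2
      omega
    · have h5 : i ≠ σ.1 a := fun h => h2 (h3.2 h)
      omega
  · rw [extend_apply_penultimate, if_neg (by omega)]
    omega
  · by_cases h : i = 2 * n + 2
    · subst h
      rw [extend_apply_top]
      omega
    · omega

theorem max_mem_closers {n : ℕ} (σ : FreeInvolution n) {a : ℕ} (ha : 1 ≤ a ∧ a ≤ 2 * n) :
    max a (σ.1 a) ∈ closers σ := by
  have h := σ.mapsTo ha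
  have hne := (σ.2.2 a).2 ha
  rw [closers, Finset.mem_filter, Finset.mem_Icc]
  rcases lt_or_gt_of_ne hne with h' | h'
  · rw [max_eq_left h'.le]
    exact ⟨ha, h'⟩
  · rw [max_eq_right h'.le, σ.2.1]
    exact ⟨h, h'⟩

theorem le_of_mem_closers {n : ℕ} {σ : FreeInvolution n} {i : ℕ} (h : i ∈ closers σ) :
    i ≤ 2 * n :=
  (Finset.mem_Icc.1 (Finset.mem_filter.1 h).1).2

theorem card_filter_closers_extend_last {n : ℕ} (σ : FreeInvolution n)
    (a : Finset.Icc 1 (2 * n + 1)) (ha : (a : ℕ) = 2 * n + 1) (p : ℕ → Prop) [DecidablePred p] :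
    ((closers (extend σ a)).filter p).card =
      ((closers σ).filter p).card + if p (2 * n + 2) then 1 else 0 := by
  rw [closers_extend_last σ a ha, Finset.filter_insert]
  split_ifs with h
  · rw [Finset.card_insert_of_notMem]
    intro h'
    have := le_of_mem_closers (Finset.mem_filter.1 h').1
    omega
  · rfl

/-- Two closers are gained, exactly one of which satisfies `p`, and the larger entry of the broken
block is lost. -/
theorem card_filter_closers_extend {n : ℕ} (σ : FreeInvolution n)
    (a : Finset.Icc 1 (2 * n + 1)) (ha : (a : ℕ) ≤ 2 * n) (p : ℕ → Prop) [DecidablePred p]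
    (hp : p (2 * n + 1) ↔ ¬ p (2 * n + 2)) :
    ((closers (extend σ a)).filter p).card =
      if p (max (a : ℕ) (σ.1 a)) then ((closers σ).filter p).card
      else ((closers σ).filter p).card + 1 := by
  have ha1 := (Finset.mem_Icc.1 a.2).1
  have hm := max_mem_closers σ ⟨ha1, ha⟩
  have key : ((closers (extend σ a)).filter p).card =
      (((closers σ).filter p).erase (max (a : ℕ) (σ.1 a))).card + 1 := by
    have hn : ∀ j, 2 * n < j → j ∉ ((closers σ).erase (max (a : ℕ) (σ.1 a))).filter p := by
      intro j hj h
      have := le_of_mem_closers (Finset.mem_of_mem_erase (Finset.mem_filter.1 h).1)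
      omega
    rw [closers_extend σ a ha, Finset.filter_insert, Finset.filter_insert, ← Finset.filter_erase]
    by_cases h : p (2 * n + 2)
    · rw [if_neg (by tauto), if_pos h, Finset.card_insert_of_notMem (hn _ (by omega))]
    · rw [if_pos (by tauto), if_neg h, Finset.card_insert_of_notMem (hn _ (by omega))]
  rw [key]
  split_ifs with h
  · exact Finset.card_erase_add_one (Finset.mem_filter.2 ⟨hm, h⟩)
  · rw [Finset.erase_eq_of_notMem]
    exact fun h' => h (Finset.mem_filter.1 h').2

/-! ### The recurrence for matchings. -/

/-- The matchings of `{1, …, 2n}` counted by blocks whose larger entry satisfies `p`. -/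
noncomputable def closerPoly (p : ℕ → Prop) [DecidablePred p] (n : ℕ) : ℤ[X] :=
  ∑ σ : FreeInvolution n, X ^ ((closers σ).filter p).card

/-- Each closer is the larger entry for two choices of `a`. With `c` closers satisfying `p`, `2c`
choices keep the count and `2(n - c)` raise it by one; `a = 2n + 1` just adds the closer `2n + 2`.
-/
theorem sum_extend {n : ℕ} (σ : FreeInvolution n) (p : ℕ → Prop) [DecidablePred p]
    (hp : p (2 * n + 1) ↔ ¬ p (2 * n + 2)) :
    ∑ a : Finset.Icc 1 (2 * n + 1), (X : ℤ[X]) ^ ((closers (extend σ a)).filter p).card =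
      X ^ ((closers σ).filter p).card *
        ((if p (2 * n + 2) then X else 1) + 2 * (((closers σ).filter p).card : ℤ[X]) +
          2 * ((n : ℤ[X]) - (((closers σ).filter p).card : ℤ[X])) * X) := by
  set c := ((closers σ).filter p).card with hc
  let G : ℕ → ℤ[X] := fun b =>
    if b = 2 * n + 1 then X ^ c * (if p (2 * n + 2) then X else 1)
    else if p (max b (σ.1 b)) then X ^ c else X ^ (c + 1)
  have h1 : ∀ a : Finset.Icc 1 (2 * n + 1),
      (X : ℤ[X]) ^ ((closers (extend σ a)).filter p).card = G a := by
    intro a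
    change _ = if _ then _ else _
    have ha := (Finset.mem_Icc.1 a.2).2
    by_cases h : (a : ℕ) = 2 * n + 1
    · simp only [if_pos h, card_filter_closers_extend_last σ a h]
      split_ifs <;> simp [hc, pow_succ]
    · simp only [if_neg h, card_filter_closers_extend σ a (by omega) p hp]
      split_ifs <;> rfl
  rw [Finset.sum_congr rfl fun a _ => h1 a, Finset.sum_coe_sort (Finset.Icc 1 (2 * n + 1)) G,
    Finset.sum_Icc_succ_top (by omega), show G (2 * n + 1) = _ from if_pos rfl]
  have h2 : ∑ b ∈ Finset.Icc 1 (2 * n), G b =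
      2 * ∑ m ∈ closers σ, if p m then (X : ℤ[X]) ^ c else X ^ (c + 1) := by
    rw [← sum_max_eq_two_mul_sum_closers σ fun m => if p m then (X : ℤ[X]) ^ c else X ^ (c + 1)]
    refine Finset.sum_congr rfl fun b hb => ?_
    have := (Finset.mem_Icc.1 hb).2
    exact if_neg (by omega)
  have h3 : (c : ℤ[X]) + (((closers σ).filter fun i => ¬ p i).card : ℤ[X]) = n := by
    rw [hc]
    exact_mod_cast (Finset.card_filter_add_card_filter_not p).trans (card_closers σ)
  rw [h2, Finset.sum_ite, Finset.sum_const, Finset.sum_const,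
    nsmul_eq_mul, nsmul_eq_mul, ← hc]
  linear_combination 2 * X ^ (c + 1) * h3

theorem closerPoly_succ (p : ℕ → Prop) [DecidablePred p] (n : ℕ)
    (hp : p (2 * n + 1) ↔ ¬ p (2 * n + 2)) :
    closerPoly p (n + 1) =
      ((if p (2 * n + 2) then X else 1) + 2 * (n : ℤ[X]) * X) * closerPoly p n +
        2 * X * (1 - X) * derivative (closerPoly p n) := by
  rw [closerPoly, ← (extendEquiv n).sum_comp, Fintype.sum_prod_type, closerPoly, derivative_sum,
    Finset.mul_sum, Finset.mul_sum, ← Finset.sum_add_distrib]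
  refine Finset.sum_congr rfl fun σ _ => ?_
  refine (sum_extend σ p hp).trans ?_
  linear_combination -2 * (1 - X) * X_mul_derivative_X_pow ((closers σ).filter p).card

theorem closerPoly_zero (p : ℕ → Prop) [DecidablePred p] : closerPoly p 0 = 1 := by
  have : Unique (FreeInvolution 0) :=
    { default := ⟨1, by simp, by simp; omega⟩
      uniq := fun σ => by
        apply Subtype.ext
        ext i
        by_contra h
        have := (σ.2.2 i).1 h
        omega }
  rw [closerPoly, Fintype.sum_unique]
  simp [closers]

theorem matchingN_eq (n : ℕ) : matchingN n = closerPoly Even n := by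
  rw [matchingN, ← (matchingEquiv n).symm.sum_comp, closerPoly]
  exact Finset.sum_congr rfl fun σ _ => congrArg _ (card_parts_filter_sup σ Even)

theorem matchingM_eq (n : ℕ) : matchingM n = closerPoly Odd n := by
  rw [matchingM, ← (matchingEquiv n).symm.sum_comp, closerPoly]
  exact Finset.sum_congr rfl fun σ _ => congrArg _ (card_parts_filter_sup σ Odd)

theorem matchingN_zero : matchingN 0 = 1 := by
  rw [matchingN_eq, closerPoly_zero]

theorem matchingM_zero : matchingM 0 = 1 := by
  rw [matchingM_eq, closerPoly_zero]

theorem matchingN_succ (n : ℕ) :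
    matchingN (n + 1) = (2 * (n : ℤ[X]) + 1) * X * matchingN n +
      2 * X * (1 - X) * derivative (matchingN n) := by
  have h : Even (2 * n + 2) := by simp [parity_simps]
  have h' : ¬ Even (2 * n + 1) := by simp [parity_simps]
  rw [matchingN_eq, matchingN_eq, closerPoly_succ Even n (by tauto), if_pos h]
  ring

theorem matchingM_succ (n : ℕ) :
    matchingM (n + 1) = (1 + 2 * (n : ℤ[X]) * X) * matchingM n +
      2 * X * (1 - X) * derivative (matchingM n) := by
  have h : ¬ Odd (2 * n + 2) := by simp [parity_simps]
  have h' : Odd (2 * n + 1) := by simp [parity_simps]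
  rw [matchingM_eq, matchingM_eq, closerPoly_succ Odd n (by tauto), if_neg h]

/-! ### Binomial convolutions -/

/-- The binomial convolution of two sequences of polynomials. -/
noncomputable def binomConv (f g : ℕ → ℤ[X]) (n : ℕ) : ℤ[X] :=
  ∑ k ∈ Finset.range (n + 1), (n.choose k : ℤ[X]) * f k * g (n - k)

theorem binomConv_zero (f g : ℕ → ℤ[X]) : binomConv f g 0 = f 0 * g 0 := by
  simp [binomConv]

/-- Pascal's rule in the form of a Leibniz rule: the index shift acts as a derivation for binomial
convolution. -/
theorem binomConv_succ (f g : ℕ → ℤ[X]) (n : ℕ) :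
    binomConv f g (n + 1) =
      binomConv (fun k => f (k + 1)) g n + binomConv f (fun k => g (k + 1)) n := by
  have h1 : ∑ k ∈ Finset.range (n + 1), (n.choose (k + 1) : ℤ[X]) * f (k + 1) * g (n - k) =
      ∑ k ∈ Finset.range n, (n.choose (k + 1) : ℤ[X]) * f (k + 1) * g (n - k) := by
    rw [Finset.sum_range_succ]
    simp
  have h2 : ∑ k ∈ Finset.range n, (n.choose (k + 1) : ℤ[X]) * f (k + 1) * g (n - k) =
      ∑ k ∈ Finset.range n, (n.choose (k + 1) : ℤ[X]) * f (k + 1) * g (n - (k + 1) + 1) := by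
    refine Finset.sum_congr rfl fun k hk => ?_
    have := Finset.mem_range.1 hk
    rw [show n - (k + 1) + 1 = n - k by omega]
  have h3 : binomConv f (fun k => g (k + 1)) n =
      ∑ k ∈ Finset.range (n + 1), (n.choose (k + 1) : ℤ[X]) * f (k + 1) * g (n - k) +
        f 0 * g (n + 1) := by
    rw [binomConv, Finset.sum_range_succ', h1, h2]
    simp
  rw [h3, binomConv, Finset.sum_range_succ', binomConv]
  simp only [Nat.choose_succ_succ, Nat.cast_add, Nat.add_sub_add_right, add_mul,
    Finset.sum_add_distrib]
  simp [add_assoc]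

/-- If two sequences satisfy first order differential recurrences with the same derivation, so
does their binomial convolution. -/
theorem binomConv_succ_of_recurrence (f g : ℕ → ℤ[X]) (a b d : ℤ[X])
    (hf : ∀ n, f (n + 1) = (a + 2 * (n : ℤ[X]) * X) * f n + d * derivative (f n))
    (hg : ∀ n, g (n + 1) = (b + 2 * (n : ℤ[X]) * X) * g n + d * derivative (g n)) (n : ℕ) :
    binomConv f g (n + 1) =
      (a + b + 2 * (n : ℤ[X]) * X) * binomConv f g n + d * derivative (binomConv f g n) := by
  rw [binomConv_succ, binomConv, binomConv, binomConv, derivative_sum, Finset.mul_sum,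
    Finset.mul_sum, ← Finset.sum_add_distrib, ← Finset.sum_add_distrib]
  refine Finset.sum_congr rfl fun k hk => ?_
  have hk' : k ≤ n := Nat.lt_succ_iff.1 (Finset.mem_range.1 hk)
  -- The growth terms `2k X` and `2(n - k) X` add up to `2n X`, independent of `k`.
  rw [hf, hg, derivative_mul, derivative_mul, derivative_natCast, Nat.cast_sub hk']
  ring

/-! ### The two identities. -/

theorem binomConv_matchingN_matchingN (n : ℕ) :
    binomConv matchingN matchingN (n + 1) = 2 ^ (n + 1) * X * eulerianA (n + 1) := by
  have hN : ∀ n, matchingN (n + 1) = (X + 2 * (n : ℤ[X]) * X) * matchingN n +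
      2 * X * (1 - X) * derivative (matchingN n) := fun n => by
    rw [matchingN_succ]; ring
  induction n with
  -- The base case is index 1: at index 0 the convolution is 1, whereas `X * eulerianA 0` is `X`.
  | zero =>
    have hA : eulerianA 0 = 1 := by simp [eulerianA_eq_sum_words, wordsA, wordDes]
    rw [binomConv_succ_of_recurrence _ _ _ _ _ hN hN, binomConv_zero, matchingN_zero,
      eulerianA_succ, hA]
    simp
    ring
  | succ n ih =>
    rw [binomConv_succ_of_recurrence _ _ _ _ _ hN hN, ih, eulerianA_succ (n + 1)]
    have h2 : derivative ((2 : ℤ[X]) ^ (n + 1)) = 0 := by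
      have := derivative_natCast (R := ℤ) (n := 2 ^ (n + 1))
      exact_mod_cast this
    -- Differentiating the factor `X` contributes `2(1 - X)`, which combines with the constant `2X`
    -- to give 2, the extra power of two.
    rw [derivative_mul, derivative_mul, h2, derivative_X]
    push_cast
    ring

theorem binomConv_matchingN_matchingM (n : ℕ) :
    binomConv matchingN matchingM n = eulerianB n := by
  have hN : ∀ n, matchingN (n + 1) = (X + 2 * (n : ℤ[X]) * X) * matchingN n +
      2 * X * (1 - X) * derivative (matchingN n) := fun n => by
    rw [matchingN_succ]; ring
  induction n with
  | zero =>
    rw [binomConv_zero, matchingN_zero, matchingM_zero]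
    simp [eulerianB_eq_sum_words, wordsB, wordDes]
  | succ n ih =>
    rw [binomConv_succ_of_recurrence _ _ _ _ _ hN matchingM_succ, ih, eulerianB_succ]
    ring

end EulerianMatching

theorem proposition1 (n : ℕ) :
    (1 ≤ n →
      (2 : ℤ[X]) ^ n * X * EulerianMatching.eulerianA n =
        ∑ k ∈ Finset.range (n + 1), (n.choose k : ℤ[X]) *
          EulerianMatching.matchingN k * EulerianMatching.matchingN (n - k)) ∧
    EulerianMatching.eulerianB n =
      ∑ k ∈ Finset.range (n + 1), (n.choose k : ℤ[X]) *
        EulerianMatching.matchingN k * EulerianMatching.matchingM (n - k) := by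
  refine ⟨fun hn => ?_, (EulerianMatching.binomConv_matchingN_matchingM n).symm⟩
  obtain ⟨m, rfl⟩ := Nat.exists_eq_add_of_le' hn
  exact (EulerianMatching.binomConv_matchingN_matchingN m).symm
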